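/- Let $p$ be a prime, let $G$ be a finite non-abelian $p$-group with centre $Z(G)$, and let $n\ge 2$. Write $\gamma_1(G)=G$, $\gamma_{k+1}(G)=[\gamma_k(G),G]$ for the lower central series. Let $\mathrm{Autcent}(G)$ be the group of automorphisms $\alpha$ of $G$ with $g^{-1}\alpha(g)\in Z(G)$ for all $g\in G$, and let $\mathrm{Aut}_c^{k}(G)$ ($k\ge 1$) be the group of automorphisms $\beta$ of $G$ such that for every $g\in G$ there is $x\in\gamma_k(G)$ with $\beta(g)=x^{-1}gx$. Let $\exp$ denote the exponent of a finite group and $d$ the rank (minimal number of generators) of a finite abelian $p$-group. If $H\le K$ are finite abelian $p$-groups with $d(H)=d(K)=s$ and $H\cong C_{p^{n_1}}\times\cdots\times C_{p^{n_s}}$, $K\cong C_{p^{m_1}}\times\cdots\times C_{p^{m_s}}$, where $n_1\ge\cdots\ge n_s\ge 1$ and $m_1\ge\cdots\ge m_s\ge 1$, put $\mathrm{var}(H,K)=1$ if $H=K$, and otherwise $\mathrm{var}(H,K)=p^{n_r}$, where $r$ is the unique index with $n_r<m_r$ and $n_j=m_j$ for all $j>r$. For a group $Q$ and an abelian group $M$,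 $\mathrm{Hom}(Q,M)$ is the group of homomorphisms $Q\to M$ under pointwise multiplication. Suppose that $\mathrm{Aut}_c^{n-1}(G)=\mathrm{Autcent}(G)$. Then (1) $\gamma_n(G)\le Z(G)$ and $d(\gamma_n(G))=d(Z(G))$; (2) if $\exp(G/\gamma_2(G))>\mathrm{var}(\gamma_n(G),Z(G))$, then $\gamma_n(G)=Z(G)$ and $\mathrm{Aut}_c^{n-1}(G)\cong\mathrm{Hom}(G/Z(G),\gamma_n(G))$. Conversely, if $\gamma_n(G)=Z(G)$ and $\mathrm{Aut}_c^{n-1}(G)\cong\mathrm{Hom}(G/Z(G),\gamma_n(G))$, then $\mathrm{Aut}_c^{n-1}(G)=\mathrm{Autcent}(G)$ and $\exp(G/\gamma_2(G))>\mathrm{var}(\gamma_n(G),Z(G))$. -/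

import Mathlib

/-- The `n`-th term `γ_n(G)` of the lower central series, indexed from `γ_1(G) = G`. Only the
indices `n ≥ 1` are meaningful; Mathlib's series starts at index `0`. -/
def gammaTerm (G : Type*) [Group G] (n : ℕ) : Subgroup G :=
  (⊤ : Subgroup G).lowerCentralSeries (n - 1)

instance gammaTerm_normal (G : Type*) [Group G] (n : ℕ) : (gammaTerm G n).Normal := by
  unfold gammaTerm; infer_instance

/-- The group `Autcent(G)` of central automorphisms of `G`. -/
def Autcent (G : Type*) [Group G] : Subgroup (MulAut G) where
  carrier := {α | ∀ g : G, g⁻¹ * α g ∈ Subgroup.center G}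
  one_mem' := by
    intro g
    simp
  mul_mem' := by
    intro α β hα hβ g
    have h := (Subgroup.center G).mul_mem (hβ g) (hα (β g))
    simpa [mul_assoc] using h
  inv_mem' := by
    intro α hα g
    have h := (Subgroup.center G).inv_mem (hα (α⁻¹ g))
    simpa using h

/-- The group `Aut_c^n(G)` of `n`-th class preserving automorphisms of `G`: every `g` is sent to a
conjugate `x⁻¹ g x` with `x ∈ γ_n(G)`, where `x` may depend on `g`. -/
def AutClass (G : Type*) [Group G] (n : ℕ) : Subgroup (MulAut G) where
  carrier := {β | ∀ g : G, ∃ x ∈ gammaTerm G n, β g = x⁻¹ * g * x}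
  one_mem' := by
    intro g
    exact ⟨1, Subgroup.one_mem _, by simp⟩
  mul_mem' := by
    intro α β hα hβ g
    obtain ⟨x, hx, hxg⟩ := hβ g
    obtain ⟨y, hy, hyg⟩ := hα (x⁻¹ * g * x)
    refine ⟨x * y, Subgroup.mul_mem _ hx hy, ?_⟩
    rw [MulAut.mul_apply, hxg, hyg]
    group
  inv_mem' := by
    intro α hα g
    obtain ⟨x, hx, hxg⟩ := hα (α⁻¹ g)
    refine ⟨x⁻¹, Subgroup.inv_mem _ hx, ?_⟩
    rw [MulAut.apply_inv_self] at hxg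
    rw [inv_inv]
    conv_rhs => rw [hxg]
    simp [mul_assoc]

/-- `A ≅ C_{p^{e_1}} × ⋯ × C_{p^{e_s}}` with positive integers `e_1 ≥ ⋯ ≥ e_s`. -/
def IsCyclicDecomposition (p : ℕ) (A : Type*) [Group A] {s : ℕ} (e : Fin s → ℕ) : Prop :=
  Antitone e ∧ (∀ i, 0 < e i) ∧ Nonempty (A ≃* ((i : Fin s) → Multiplicative (ZMod (p ^ e i))))

/-- `v` is the value `var(H, K)`: it is `1` if `H = K`; if `H` is a proper subgroup of `K` with the
same number `s` of cyclic factors, it is `p ^ n_r`, where `r` is the last index at which the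
exponents of the cyclic factors of `H` and of `K` differ. -/
def IsVar (p : ℕ) {G : Type*} [Group G] (H K : Subgroup G) (v : ℕ) : Prop :=
  (H = K ∧ v = 1) ∨
  (H < K ∧ ∃ (s : ℕ) (n m : Fin s → ℕ),
    IsCyclicDecomposition p H n ∧ IsCyclicDecomposition p K m ∧
    ∃ r : Fin s, n r < m r ∧ (∀ j : Fin s, r < j → n j = m j) ∧ v = p ^ n r)

/-- `var(H, K)` for finite abelian `p`-subgroups `H ≤ K` of the same rank. There is then exactly one
`v` with `IsVar p H K v`, and `sInf` picks it; for other pairs the value carries no meaning. -/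
noncomputable def varPair (p : ℕ) {G : Type*} [Group G] (H K : Subgroup G) : ℕ :=
  sInf {v : ℕ | IsVar p H K v}

section
open scoped IsMulCommutative

/-- `M` is abelian and the group `A` is isomorphic to the group `Hom(Q, M)` of all homomorphisms
from `Q` to `M` under pointwise multiplication. -/
def IsoToHom (A Q M : Type*) [Group A] [Group Q] [Group M] : Prop :=
  ∃ _ : IsMulCommutative M, Nonempty (A ≃* (Q →* M))

end

/-! Write `γ = γ_n(G)` and `Z = Z(G)`. If `f : G → Z` is a homomorphism such that `z f(z) = 1` with
`z ∈ Z` forces `z = 1`, then `g ↦ g f(g)` is a central automorphism. When it is also class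
preserving by `γ_{n-1}(G)`, `f` takes values in `γ` and kills `Z`.

For `z ∈ Z` of order `p`, a map through `G/⟨z⟩` onto `⟨z⟩` shows that `z ∈ γ`
(`mem_gammaTerm_of_pow_eq_one`). So `γ` and `Z` have the same socle, hence the same rank. Since `γ ≤
γ_2(G)`, every `f : G → Z` kills this socle and therefore satisfies the condition above
(`apply_mem_gammaTerm_of_autClass_eq`). Thus `γ` contains all `z ∈ Z` of order at most
`exp(G/γ_2(G))`, and if this bound exceeds `var(γ, Z)`, counting cyclic factors rules out `γ < Z`
(`eq_of_isVar_lt`).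

The isomorphism with `Hom` is `α ↦ (g ↦ g⁻¹ α(g))` (`centralHom`). For the converse this map is
injective, hence bijective by comparing orders. -/

/-! ### Invariants of cyclic decompositions -/

/-- The elements of `A` of order dividing `p` which are `p ^ k`-th powers. -/
def powSocle (p k : ℕ) (A : Type*) [Group A] : Set A :=
  {y | y ^ p = 1 ∧ ∃ x : A, x ^ p ^ k = y}

theorem exists_isCyclicDecomposition {p : ℕ} (hp : p.Prime) {A : Type*} [CommGroup A] [Finite A]
    (hA : IsPGroup p A) : ∃ (s : ℕ) (e : Fin s → ℕ), IsCyclicDecomposition p A e := by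
  obtain ⟨ι, _, n, hn, ⟨φ⟩⟩ := CommGroup.equiv_prod_multiplicative_zmod_of_finite A
  have := Fact.mk hp
  obtain ⟨N, hN⟩ := IsPGroup.iff_card.mp hA
  have key : ∀ i, ∃ a, n i = p ^ a := by
    intro i
    have hd : n i ∣ p ^ N := by
      have h := Nat.card_congr φ.toEquiv
      rw [hN, Nat.card_pi] at h
      rw [h]
      rw [show n i = Nat.card (Multiplicative (ZMod (n i))) from (Nat.card_zmod (n i)).symm]
      exact Finset.dvd_prod_of_mem (fun i => Nat.card (Multiplicative (ZMod (n i))))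
        (Finset.mem_univ i)
    obtain ⟨a, -, ha⟩ := (Nat.dvd_prime_pow hp).1 hd
    exact ⟨a, ha⟩
  choose e he using key
  obtain rfl : n = fun i => p ^ e i := funext he
  obtain ⟨τ⟩ : Nonempty (Fin (Fintype.card ι) ≃ ι) := ⟨(Fintype.equivFin ι).symm⟩
  -- `Tuple.sort` sorts increasingly; the order dual makes the exponents decrease.
  let σ : Fin (Fintype.card ι) ≃ ι := (Tuple.sort (fun i => OrderDual.toDual (e (τ i)))).trans τ
  refine ⟨Fintype.card ι, fun i => e (σ i), fun i j hij => ?_, fun i => ?_, ⟨φ.trans ?_⟩⟩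
  · exact Tuple.monotone_sort (fun i => OrderDual.toDual (e (τ i))) hij
  · by_contra h0
    have h1 : 1 < p ^ e (σ i) := hn (σ i)
    rw [show e (σ i) = 0 from Nat.eq_zero_of_not_pos h0, pow_zero] at h1
    exact lt_irrefl _ h1
  · exact
      { (Equiv.piCongrLeft (fun i => Multiplicative (ZMod (p ^ e i))) σ).symm with
        map_mul' := fun _ _ => rfl }

/-- The `p ^ k`-th powers form a cyclic group, nontrivial exactly when `k < e`, and then it contains
the unique subgroup of order `p`. -/
theorem card_powSocle_multiplicative_zmod {p : ℕ} (hp : p.Prime) (k e : ℕ) :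
    Nat.card (powSocle p k (Multiplicative (ZMod (p ^ e)))) = if k < e then p else 1 := by
  have : NeZero (p ^ e) := ⟨pow_ne_zero _ hp.ne_zero⟩
  split_ifs with hk
  · have hset : powSocle p k (Multiplicative (ZMod (p ^ e))) =
        (Subgroup.zpowers (Multiplicative.ofAdd ((p ^ (e - 1) : ℕ) : ZMod (p ^ e))) :
          Set (Multiplicative (ZMod (p ^ e)))) := by
      have hpe : p ^ e = p ^ (e - 1) * p := by rw [← pow_succ]; congr; omega
      have hpk : p ^ (e - 1) = p ^ (e - 1 - k) * p ^ k := by rw [← pow_add]; congr; omega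
      ext y
      simp only [powSocle, Set.mem_ofPred_eq, SetLike.mem_coe, Subgroup.mem_zpowers_iff]
      constructor
      · rintro ⟨h1, -⟩
        have h2 : ((p * (Multiplicative.toAdd y).val : ℕ) : ZMod (p ^ e)) = 0 := by
          have := congrArg Multiplicative.toAdd h1
          simpa using this
        rw [ZMod.natCast_eq_zero_iff] at h2
        obtain ⟨t, ht⟩ := Nat.dvd_of_mul_dvd_mul_left hp.pos
          ((dvd_of_eq ((mul_comm _ _).trans hpe.symm)).trans h2)
        refine ⟨t, ?_⟩
        apply Multiplicative.toAdd.injective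
        have h3 := congrArg (Nat.cast (R := ZMod (p ^ e))) ht
        simp only [ZMod.natCast_val, ZMod.cast_id', id] at h3
        rw [h3]
        simp [mul_comm]
      · rintro ⟨t, rfl⟩
        constructor
        · rw [← zpow_natCast, ← zpow_mul, mul_comm, zpow_mul, zpow_natCast, ← ofAdd_nsmul,
            nsmul_eq_mul, ← Nat.cast_mul, mul_comm, ← hpe]
          simp
        · refine ⟨Multiplicative.ofAdd ((p ^ (e - 1 - k) : ℕ) : ZMod (p ^ e)) ^ t, ?_⟩
          rw [← zpow_natCast, ← zpow_mul, mul_comm, zpow_mul, zpow_natCast, ← ofAdd_nsmul,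
            nsmul_eq_mul, ← Nat.cast_mul, mul_comm, ← hpk]
    rw [hset]
    change Nat.card (Subgroup.zpowers _) = p
    rw [Nat.card_zpowers, orderOf_ofAdd_eq_addOrderOf, ZMod.addOrderOf_coe _ this.out,
      Nat.gcd_eq_right (pow_dvd_pow _ (Nat.sub_le _ _)), Nat.pow_div (Nat.sub_le _ _) hp.pos]
    rw [show e - (e - 1) = 1 by omega, pow_one]
  · have hset : powSocle p k (Multiplicative (ZMod (p ^ e))) = {1} := by
      ext y
      simp only [powSocle, Set.mem_ofPred_eq, Set.mem_singleton_iff]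
      constructor
      · rintro ⟨-, x, rfl⟩
        obtain ⟨d, rfl⟩ := Nat.exists_eq_add_of_le (not_lt.mp hk)
        rw [pow_add, pow_mul]
        convert one_pow (M := Multiplicative (ZMod (p ^ e))) (p ^ d)
        apply Multiplicative.toAdd.injective
        rw [toAdd_pow, nsmul_eq_mul, ZMod.natCast_self, zero_mul, toAdd_one]
      · rintro rfl
        exact ⟨one_pow _, 1, one_pow _⟩
    rw [hset]
    simp

/-- These counts, for all `k`, determine the exponents; subgroups are compared through them. -/
theorem card_powSocle {p : ℕ} (hp : p.Prime) {A : Type*} [Group A] {s : ℕ} {e : Fin s → ℕ}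
    (h : IsCyclicDecomposition p A e) (k : ℕ) :
    Nat.card (powSocle p k A) = p ^ (Finset.univ.filter fun i => k < e i).card := by
  obtain ⟨-, -, ⟨φ⟩⟩ := h
  have h1 : Nat.card (powSocle p k A) =
      Nat.card ((i : Fin s) → powSocle p k (Multiplicative (ZMod (p ^ e i)))) := by
    refine Nat.card_congr ((φ.toEquiv.subtypeEquiv (q := fun f => ∀ i, f i ∈ powSocle p k _)
      fun a => ?_).trans (Equiv.subtypePiEquivPi))
    simp only [powSocle, Set.mem_ofPred_eq, MulEquiv.toEquiv_eq_coe, EquivLike.coe_coe]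
    constructor
    · rintro ⟨ha, x, rfl⟩ i
      refine ⟨?_, φ x i, by simp⟩
      rw [← Pi.pow_apply, ← map_pow, ha, map_one, Pi.one_apply]
    · intro ha
      choose ha x hx using ha
      refine ⟨φ.injective ?_, φ.symm x, φ.injective ?_⟩
      · rw [map_pow, map_one]; exact funext ha
      · rw [map_pow, MulEquiv.apply_symm_apply]; exact funext hx
  rw [h1, Nat.card_pi]
  simp only [card_powSocle_multiplicative_zmod hp]
  rw [Finset.prod_ite, Finset.prod_const, Finset.prod_const_one, mul_one]

theorem card_eq_of_isCyclicDecomposition {p : ℕ} {A : Type*} [Group A] {s : ℕ} {e : Fin s → ℕ}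
    (h : IsCyclicDecomposition p A e) : Nat.card A = ∏ i, p ^ e i := by
  obtain ⟨-, -, ⟨φ⟩⟩ := h
  rw [Nat.card_congr φ.toEquiv, Nat.card_pi]
  exact Finset.prod_congr rfl fun i _ => Nat.card_zmod _

/-- A generating set of the group spans the vector space `𝔽_p^s`. -/
theorem le_rank_pi_multiplicative_zmod (p s : ℕ) [Fact p.Prime] :
    s ≤ Group.rank (Fin s → Multiplicative (ZMod p)) := by
  classical
  obtain ⟨S, hS, hS'⟩ := Group.rank_spec (Fin s → Multiplicative (ZMod p))
  rw [← hS]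
  let c : (Fin s → Multiplicative (ZMod p)) → (Fin s → ZMod p) :=
    fun f i => Multiplicative.toAdd (f i)
  let N := Submodule.span (ZMod p) ((S.image c : Finset (Fin s → ZMod p)) : Set (Fin s → ZMod p))
  let K : Subgroup (Fin s → Multiplicative (ZMod p)) :=
    { carrier := {f | c f ∈ N}
      one_mem' := show (0 : Fin s → ZMod p) ∈ N from N.zero_mem
      mul_mem' := fun {a b} ha hb => show c a + c b ∈ N from N.add_mem ha hb
      inv_mem' := fun {a} ha => show -c a ∈ N from N.neg_mem ha }
  have hK : Subgroup.closure (S : Set (Fin s → Multiplicative (ZMod p))) ≤ K :=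
    (Subgroup.closure_le _).2 fun f hf =>
      show c f ∈ N from Submodule.subset_span (Finset.mem_coe.2 (Finset.mem_image_of_mem c hf))
  rw [hS'] at hK
  have hN : N = ⊤ := by
    rw [eq_top_iff]
    intro v _
    exact hK (Subgroup.mem_top fun i => Multiplicative.ofAdd (v i))
  have h := finrank_span_finset_le_card (R := ZMod p) (S.image c)
  rw [Set.finrank, show Submodule.span (ZMod p) _ = ⊤ from hN, finrank_top,
    Module.finrank_fin_fun] at h
  exact h.trans Finset.card_image_le

/-- The standard generators bound the rank above; reduction modulo `p` onto `(ℤ/p)^s` bounds it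
below. -/
theorem rank_eq_of_isCyclicDecomposition {p : ℕ} (hp : p.Prime) {A : Type*} [Group A]
    [Finite A] {s : ℕ} {e : Fin s → ℕ} (h : IsCyclicDecomposition p A e) : Group.rank A = s := by
  obtain ⟨-, hpos, ⟨φ⟩⟩ := h
  have := Fact.mk hp
  have (i : Fin s) : NeZero (p ^ e i) := ⟨pow_ne_zero _ hp.ne_zero⟩
  apply le_antisymm
  · rw [Group.rank_congr φ]
    classical
    let g : Fin s → ((i : Fin s) → Multiplicative (ZMod (p ^ e i))) := fun i =>
      Pi.mulSingle i (Multiplicative.ofAdd 1)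
    have hg : Subgroup.closure ((Finset.univ.image g : Finset ((i : Fin s) → Multiplicative (ZMod (p ^ e i)))) :
        Set ((i : Fin s) → Multiplicative (ZMod (p ^ e i)))) = ⊤ := by
      rw [eq_top_iff]
      intro f _
      rw [← Finset.univ_prod_mulSingle f]
      refine Subgroup.prod_mem _ fun i _ => ?_
      have hi : Pi.mulSingle i (f i) = g i ^ (Multiplicative.toAdd (f i)).val := by
        rw [← Pi.mulSingle_pow, ← ofAdd_nsmul]
        simp
      rw [hi]
      exact Subgroup.pow_mem _ (Subgroup.subset_closure (by simp)) _
    refine (Group.rank_le hg).trans (Finset.card_image_le.trans ?_)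
    simp
  · let ψ : ((i : Fin s) → Multiplicative (ZMod (p ^ e i))) →* (Fin s → Multiplicative (ZMod p)) :=
      MonoidHom.mk' (fun f i => Multiplicative.ofAdd
        (ZMod.castHom (dvd_pow_self p (hpos i).ne') (ZMod p) (Multiplicative.toAdd (f i))))
        fun f g => by
          funext i
          rw [Pi.mul_apply, toAdd_mul, map_add, ofAdd_add]
          rfl
    have hψ : Function.Surjective ψ := by
      intro v
      choose u hu using fun i => ZMod.castHom_surjective (dvd_pow_self p (hpos i).ne')
        (Multiplicative.toAdd (v i))
      exact ⟨fun i => Multiplicative.ofAdd (u i), funext fun i => congrArg Multiplicative.ofAdd (hu i)⟩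
    exact (le_rank_pi_multiplicative_zmod p s).trans
      (Group.rank_le_of_surjective (ψ.comp φ.toMonoidHom) (hψ.comp φ.surjective))

/-! ### Homomorphisms with a prescribed value -/

/-- Project onto a cyclic factor of order at least `p ^ a` and send its generator to `w`. -/
theorem exists_hom_mem_range {p : ℕ} (hp : p.Prime) {A : Type*} [CommGroup A] [Finite A]
    (hA : IsPGroup p A) {M : Type*} [CommGroup M] {w : M} {a : ℕ} (hw : w ^ p ^ a = 1)
    (ha : p ^ a ≤ Monoid.exponent A) : ∃ f : A →* M, ∃ x, f x = w := by
  obtain ⟨s, e, -, -, ⟨φ⟩⟩ := exists_isCyclicDecomposition hp hA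
  by_cases h : ∃ i, a ≤ e i
  · obtain ⟨i, hi⟩ := h
    let l : ZMod (p ^ e i) →+ Additive M := ZMod.lift _ ⟨zmultiplesHom _ (Additive.ofMul w), by
      obtain ⟨d, hd⟩ := Nat.exists_eq_add_of_le hi
      rw [hd, pow_add]
      simp only [zmultiplesHom_apply, natCast_zsmul, ← ofMul_pow, pow_mul, hw, one_pow, ofMul_one]⟩
    refine ⟨((AddMonoidHom.toMultiplicativeLeft l).comp (Pi.evalMonoidHom _ i)).comp
      φ.toMonoidHom, φ.symm (fun _ => Multiplicative.ofAdd 1), ?_⟩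
    have : l 1 = Additive.ofMul w := by
      have := ZMod.lift_coe (p ^ e i) ⟨zmultiplesHom _ (Additive.ofMul w), by
        obtain ⟨d, hd⟩ := Nat.exists_eq_add_of_le hi
        rw [hd, pow_add]
        simp only [zmultiplesHom_apply, natCast_zsmul, ← ofMul_pow, pow_mul, hw, one_pow,
          ofMul_one]⟩ 1
      simpa using this
    simp [this]
  · push Not at h
    -- With no cyclic factors at all, `a = 0` also lands here; for `a > 0` the exponent would divide
    -- `p ^ (a - 1)`.
    rcases Nat.eq_zero_or_pos a with rfl | hpos
    · exact ⟨1, 1, by simpa using hw.symm⟩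
    exfalso
    have hdvd : Monoid.exponent A ∣ p ^ (a - 1) := by
      refine Monoid.exponent_dvd_of_forall_pow_eq_one fun g => φ.injective ?_
      rw [map_pow, map_one]
      funext i
      obtain ⟨d, hd⟩ := Nat.exists_eq_add_of_le (Nat.le_sub_one_of_lt (h i))
      rw [Pi.pow_apply, hd, pow_add, pow_mul]
      convert one_pow (M := Multiplicative (ZMod (p ^ e i))) (p ^ d)
      apply Multiplicative.toAdd.injective
      rw [toAdd_pow, nsmul_eq_mul, ZMod.natCast_self, zero_mul]
      · rfl
      · rfl
    have h1 := Nat.le_of_dvd (pow_pos hp.pos _) hdvd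
    have h2 := Nat.pow_lt_pow_right hp.one_lt (Nat.sub_one_lt hpos.ne')
    omega

/-! ### Comparing a subgroup with the whole, and `var` -/

theorem powSocle_card_mono (p k : ℕ) {G : Type*} [Group G] [Finite G] {H K : Subgroup G}
    (hHK : H ≤ K) : Nat.card (powSocle p k H) ≤ Nat.card (powSocle p k K) := by
  refine Nat.card_le_card_of_injective (fun y => ⟨Subgroup.inclusion hHK y.1, ?_, ?_⟩) ?_
  · rw [← map_pow, y.2.1, map_one]
  · obtain ⟨x, hx⟩ := y.2.2
    exact ⟨Subgroup.inclusion hHK x, by rw [← map_pow, hx]⟩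
  · intro y y' h
    exact Subtype.ext (Subgroup.inclusion_injective hHK (Subtype.ext_iff.1 h))

/-- A `p ^ k`-th root of an element killed by `p` is killed by `p ^ (k + 1)`, so it already lies in
`H`. -/
theorem powSocle_card_le_of_torsion_mem {p k : ℕ} {G : Type*} [Group G] [Finite G]
    {H K : Subgroup G} (h : ∀ z ∈ K, z ^ p ^ (k + 1) = 1 → z ∈ H) :
    Nat.card (powSocle p k K) ≤ Nat.card (powSocle p k H) := by
  have key : ∀ y : powSocle p k K, ∃ x : H, (x : G) ^ p ^ k = y.1 := by
    rintro ⟨_, hy, x, rfl⟩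
    refine ⟨⟨x, h x x.2 ?_⟩, by simp⟩
    rw [pow_succ, pow_mul]
    simpa using congrArg (Subtype.val) hy
  choose x hx using key
  refine Nat.card_le_card_of_injective (fun y => ⟨x y ^ p ^ k, ?_, x y, rfl⟩) ?_
  · apply Subtype.ext
    rw [Subgroup.coe_pow, Subgroup.coe_pow, hx, ← Subgroup.coe_pow, y.2.1]
    rfl
  · intro y y' h
    have h' := congrArg Subtype.val (congrArg Subtype.val h)
    simp only [Subgroup.coe_pow, hx] at h'
    exact Subtype.ext (Subtype.ext h')

theorem card_filter_zero_lt {p : ℕ} {A : Type*} [Group A] {s : ℕ} {e : Fin s → ℕ}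
    (h : IsCyclicDecomposition p A e) : (Finset.univ.filter fun i => 0 < e i).card = s := by
  rw [Finset.filter_true_of_mem fun i _ => h.2.1 i]
  simp

theorem rank_eq_of_torsion_mem {p : ℕ} (hp : p.Prime) {G : Type*} [Group G] [Finite G]
    {H K : Subgroup G} (hHK : H ≤ K) (h : ∀ z ∈ K, z ^ p = 1 → z ∈ H) {s t : ℕ}
    {e : Fin s → ℕ} {f : Fin t → ℕ} (he : IsCyclicDecomposition p H e)
    (hf : IsCyclicDecomposition p K f) : s = t := by
  have h1 := powSocle_card_mono p 0 hHK
  have h2 := powSocle_card_le_of_torsion_mem (p := p) (k := 0) (H := H) (K := K) (by simpa using h)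
  have h3 := le_antisymm h1 h2
  rw [card_powSocle hp he, card_powSocle hp hf, card_filter_zero_lt he, card_filter_zero_lt hf] at h3
  exact Nat.pow_right_injective hp.two_le h3

/-- Otherwise, at level `f i`, `H` would have more than `i` larger exponents and `K` at most `i`. -/
theorem IsCyclicDecomposition.le_of_le {p : ℕ} (hp : p.Prime) {G : Type*} [Group G] [Finite G]
    {H K : Subgroup G} (hHK : H ≤ K) {s : ℕ} {e f : Fin s → ℕ}
    (he : IsCyclicDecomposition p H e) (hf : IsCyclicDecomposition p K f) (i : Fin s) :
    e i ≤ f i := by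
  by_contra! hlt
  have h1 := powSocle_card_mono p (f i) hHK
  rw [card_powSocle hp he, card_powSocle hp hf, Nat.pow_le_pow_iff_right hp.one_lt] at h1
  have h2 := (Tuple.lt_card_gt_iff_apply_gt_of_antitone he.1).2 hlt
  have h3 := (Tuple.lt_card_gt_iff_apply_gt_of_antitone hf.1).1 (h2.trans_le h1)
  exact lt_irrefl _ h3

/-- Ensures that the `sInf` in `varPair` is attained and is not the default `0` of the empty set. -/
theorem exists_isVar {p : ℕ} (hp : p.Prime) {G : Type*} [Group G] [Finite G]
    {H K : Subgroup G} (hHK : H ≤ K) {s : ℕ} {e f : Fin s → ℕ}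
    (he : IsCyclicDecomposition p H e) (hf : IsCyclicDecomposition p K f) :
    ∃ v, IsVar p H K v := by
  rcases hHK.eq_or_lt with h | hlt
  · exact ⟨1, Or.inl ⟨h, rfl⟩⟩
  have hne : (Finset.univ.filter fun i => e i ≠ f i).Nonempty := by
    by_contra h
    have hef : ∀ i, e i = f i := by
      simpa [Finset.not_nonempty_iff_eq_empty, Finset.filter_eq_empty_iff] using h
    refine hlt.ne (Subgroup.eq_of_le_of_card_ge hHK ?_)
    rw [card_eq_of_isCyclicDecomposition he, card_eq_of_isCyclicDecomposition hf, funext hef]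
  let r := (Finset.univ.filter fun i => e i ≠ f i).max' hne
  have hr : e r ≠ f r := (Finset.mem_filter.1 (Finset.max'_mem _ hne)).2
  refine ⟨p ^ e r, Or.inr ⟨hlt, s, e, f, he, hf, r,
    lt_of_le_of_ne (he.le_of_le hp hHK hf r) hr, fun j hj => ?_, rfl⟩⟩
  by_contra hne'
  exact absurd (Finset.le_max' _ j (Finset.mem_filter.2 ⟨Finset.mem_univ _, hne'⟩)) (not_le.2 hj)

/-- At level `e r`, the larger group has more than `r` bigger exponents and the smaller at most `r`;
yet both share all elements killed by `p ^ (e r + 1)`, so the counts agree. -/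
theorem eq_of_isVar_lt {p : ℕ} (hp : p.Prime) {G : Type*} [Group G] [Finite G]
    {H K : Subgroup G} {v N : ℕ} (hv : IsVar p H K v) (hN : ∃ a, N = p ^ a) (hvN : v < N)
    (h : ∀ a, p ^ a ≤ N → ∀ z ∈ K, z ^ p ^ a = 1 → z ∈ H) : H = K := by
  rcases hv with ⟨h, -⟩ | ⟨-, s, e, f, he, hf, r, hr, -, rfl⟩
  · exact h
  exfalso
  obtain ⟨a, rfl⟩ := hN
  have ha : e r + 1 ≤ a := (Nat.pow_lt_pow_iff_right hp.one_lt).1 hvN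
  have h1 := powSocle_card_le_of_torsion_mem (h (e r + 1) (Nat.pow_le_pow_right hp.pos ha))
  rw [card_powSocle hp he, card_powSocle hp hf, Nat.pow_le_pow_iff_right hp.one_lt] at h1
  have h2 := (Tuple.lt_card_gt_iff_apply_gt_of_antitone hf.1).2 hr
  exact lt_irrefl _ ((Tuple.lt_card_gt_iff_apply_gt_of_antitone he.1).1 (h2.trans_le h1))

/-! ### Central automorphisms as homomorphisms into the centre -/

section
open scoped IsMulCommutative commutatorElement

theorem gammaTerm_two (G : Type*) [Group G] : gammaTerm G 2 = commutator G := rfl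

theorem gammaTerm_succ_le_commutator (G : Type*) [Group G] {k : ℕ} (hk : 1 ≤ k) :
    gammaTerm G (k + 1) ≤ commutator G := by
  rw [← gammaTerm_two]
  exact Subgroup.lowerCentralSeries_antitone _ (by omega)

theorem inv_mul_conj_mem_gammaTerm {G : Type*} [Group G] {k : ℕ} (hk : 1 ≤ k) {x : G}
    (hx : x ∈ gammaTerm G k) (g : G) : g⁻¹ * (x⁻¹ * g * x) ∈ gammaTerm G (k + 1) := by
  obtain ⟨j, rfl⟩ := Nat.exists_eq_add_of_le' hk
  have h : ⁅x⁻¹, g⁻¹⁆ ∈ gammaTerm G (j + 1 + 1) :=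
    Subgroup.commutator_mem_commutator (inv_mem hx) (Subgroup.mem_top _)
  have h' := inv_mem h
  rw [commutatorElement_inv] at h'
  simpa [commutatorElement_def, mul_assoc] using h'

theorem inv_mul_apply_mem_of_mem_autClass {G : Type*} [Group G] {k : ℕ} (hk : 1 ≤ k)
    {β : MulAut G} (hβ : β ∈ AutClass G k) (g : G) : g⁻¹ * β g ∈ gammaTerm G (k + 1) := by
  obtain ⟨x, hx, hg⟩ := hβ g
  rw [hg]
  exact inv_mul_conj_mem_gammaTerm hk hx g

theorem apply_eq_of_mem_autClass_of_mem_center {G : Type*} [Group G] {k : ℕ}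
    {β : MulAut G} (hβ : β ∈ AutClass G k) {z : G} (hz : z ∈ Subgroup.center G) : β z = z := by
  obtain ⟨x, -, hg⟩ := hβ z
  rw [hg, mul_assoc, ← Subgroup.mem_center_iff.1 hz x, inv_mul_cancel_left]

/-- The homomorphism `g ↦ g⁻¹ α(g)` attached to a central automorphism. -/
def Autcent.hom {G : Type*} [Group G] (α : MulAut G) (hα : α ∈ Autcent G) :
    G →* Subgroup.center G :=
  MonoidHom.mk' (fun g => ⟨g⁻¹ * α g, hα g⟩) fun a b => by
    apply Subtype.ext
    have h := Subgroup.mem_center_iff.1 (hα a) b⁻¹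
    simp only [map_mul, mul_inv_rev, Subgroup.coe_mul]
    calc b⁻¹ * a⁻¹ * (α a * α b) = b⁻¹ * (a⁻¹ * α a) * α b := by group
      _ = a⁻¹ * α a * (b⁻¹ * α b) := by rw [h]; group

/-- If `g f(g) = 1`, then `g = f(g)⁻¹` is central, so the condition on the centre gives injectivity;
finiteness gives bijectivity. -/
theorem exists_mem_autcent {G : Type*} [Group G] [Finite G] (f : G →* Subgroup.center G)
    (hf : ∀ z ∈ Subgroup.center G, z * f z = 1 → z = 1) :
    ∃ α ∈ Autcent G, ∀ g, α g = g * f g := by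
  let φ : G →* G := MonoidHom.mk' (fun g => g * f g) fun a b => by
    have h := Subgroup.mem_center_iff.1 (f a).2 b
    rw [map_mul, Subgroup.coe_mul, ← mul_assoc, mul_assoc a b, h]
    group
  have hφ : Function.Injective φ := by
    rw [injective_iff_map_eq_one]
    intro g hg
    have hg' : g * f g = 1 := hg
    refine hf g ?_ hg'
    rw [mul_eq_one_iff_eq_inv.1 hg']
    exact inv_mem (f g).2
  refine ⟨MulEquiv.ofBijective φ (Finite.injective_iff_bijective.1 hφ), fun g => ?_, fun g => rfl⟩
  change g⁻¹ * (g * f g) ∈ _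
  rw [inv_mul_cancel_left]
  exact (f g).2

theorem MonoidHom.eq_one_of_mem_commutator {G M : Type*} [Group G] [CommGroup M] (f : G →* M)
    {z : G} (hz : z ∈ commutator G) : f z = 1 :=
  Abelianization.commutator_subset_ker f hz

/-- The homomorphism `α ↦ (g ↦ g⁻¹ α(g))` on a group of central automorphisms which fix the
centre pointwise. -/
def centralHom {G : Type*} [Group G] (H : Subgroup (MulAut G)) (h1 : H ≤ Autcent G)
    (h2 : ∀ α ∈ H, ∀ z ∈ Subgroup.center G, α z = z) :
    H →* (G ⧸ Subgroup.center G →* Subgroup.center G) :=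
  MonoidHom.mk' (fun α => QuotientGroup.lift _ (Autcent.hom α.1 (h1 α.2)) fun z hz =>
      Subtype.ext (inv_mul_eq_one.2 (h2 α.1 α.2 z hz).symm)) fun α β => by
    ext g
    change g⁻¹ * α.1 (β.1 g) = g⁻¹ * α.1 g * (g⁻¹ * β.1 g)
    have h := h2 α.1 α.2 _ (h1 β.2 g)
    rw [map_mul, map_inv, inv_mul_eq_iff_eq_mul] at h
    rw [h, mul_assoc]

theorem centralHom_apply_mk {G : Type*} [Group G] {H : Subgroup (MulAut G)} (h1 : H ≤ Autcent G)
    (h2 : ∀ α ∈ H, ∀ z ∈ Subgroup.center G, α z = z) (α : H) (g : G) :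
    (centralHom H h1 h2 α g : G) = g⁻¹ * α.1 g := rfl

theorem centralHom_injective {G : Type*} [Group G] {H : Subgroup (MulAut G)} (h1 : H ≤ Autcent G)
    (h2 : ∀ α ∈ H, ∀ z ∈ Subgroup.center G, α z = z) :
    Function.Injective (centralHom H h1 h2) := by
  intro α β h
  apply Subtype.ext
  ext g
  have h' := congrArg Subtype.val (DFunLike.congr_fun h (g : G ⧸ Subgroup.center G))
  rw [centralHom_apply_mk, centralHom_apply_mk] at h'
  exact mul_left_cancel h'

theorem isoToHom_of_mulEquiv {A Q G : Type*} [Group A] [Group Q] [Group G]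
    (φ : A ≃* (Q →* Subgroup.center G)) : IsoToHom A Q (Subgroup.center G) :=
  ⟨⟨⟨mul_comm⟩⟩, ⟨φ⟩⟩

theorem IsoToHom.card_eq {A Q M : Type*} [Group A] [Group Q] [Group M] (h : IsoToHom A Q M) :
    Nat.card A = Nat.card (Q →* M) := by
  obtain ⟨_, ⟨φ⟩⟩ := h
  exact Nat.card_congr φ.toEquiv

/-! ### Consequences of `AutClass G k = Autcent G`, and the converse -/

section AutClassEqAutcent

variable {G : Type*} [Group G] {k : ℕ}

/-- Conjugation by an element of `γ_k(G)` is class preserving, hence central, so its commutators are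
central. -/
theorem gammaTerm_le_center_of_autClass_eq (hk : 1 ≤ k) (h : AutClass G k = Autcent G) :
    gammaTerm G (k + 1) ≤ Subgroup.center G := by
  obtain ⟨j, rfl⟩ := Nat.exists_eq_add_of_le' hk
  refine Subgroup.commutator_le.2 fun x hx g _ => ?_
  have hmem : MulAut.conj x ∈ AutClass G (j + 1) := fun y =>
    ⟨x⁻¹, inv_mem hx, by simp⟩
  rw [h] at hmem
  have h1 := inv_mem (hmem g⁻¹)
  simpa [commutatorElement_def, mul_assoc] using h1

theorem coe_hom_mem_gammaTerm_of_autClass_eq [Finite G] (hk : 1 ≤ k) (h : AutClass G k = Autcent G)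
    (f : G →* Subgroup.center G) (hf : ∀ z ∈ Subgroup.center G, z * f z = 1 → z = 1) :
    (∀ g, (f g : G) ∈ gammaTerm G (k + 1)) ∧ ∀ z ∈ Subgroup.center G, f z = 1 := by
  obtain ⟨α, hα, hαf⟩ := exists_mem_autcent f hf
  rw [← h] at hα
  constructor
  · intro g
    have := inv_mul_apply_mem_of_mem_autClass hk hα g
    rwa [hαf, inv_mul_cancel_left] at this
  · intro z hz
    have := apply_eq_of_mem_autClass_of_mem_center hα hz
    rw [hαf, mul_eq_left] at this
    exact Subtype.ext this

/-- The homomorphism used has image in `⟨z⟩` and kills `⟨z⟩`: if `y F(y) = 1`, then `y ∈ ⟨z⟩`, so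
`F(y) = 1` and `y = 1`. -/
theorem mem_gammaTerm_of_pow_eq_one [Finite G] {p : ℕ} (hp : p.Prime) (hG : IsPGroup p G)
    (hna : ¬ ∀ a b : G, a * b = b * a) (hk : 1 ≤ k) (h : AutClass G k = Autcent G) {z : G}
    (hz : z ∈ Subgroup.center G) (hzp : z ^ p = 1) : z ∈ gammaTerm G (k + 1) := by
  have := Fact.mk hp
  have hzn : (Subgroup.zpowers z).Normal := ⟨fun x hx g => by
    obtain ⟨m, rfl⟩ := Subgroup.mem_zpowers_iff.1 hx
    have hc := Subgroup.mem_center_iff.1 ((Subgroup.center G).zpow_mem hz m) g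
    rwa [hc, mul_inv_cancel_right]⟩
  let Q := G ⧸ Subgroup.zpowers z
  have hQ : IsPGroup p Q := hG.to_quotient _
  -- Otherwise `G = ⟨z⟩` would be abelian.
  have hQn : Nontrivial Q := by
    rw [QuotientGroup.nontrivial_iff]
    intro htop
    refine hna fun a b => ?_
    obtain ⟨m, rfl⟩ := Subgroup.mem_zpowers_iff.1 (htop ▸ Subgroup.mem_top a)
    exact (Subgroup.mem_center_iff.1 ((Subgroup.center G).zpow_mem hz m) b).symm
  have : Group.IsNilpotent Q := hQ.isNilpotent
  have hAn : Nontrivial (Abelianization Q) :=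
    QuotientGroup.nontrivial_iff.2 (Group.IsSolvable.commutator_lt_top_of_nontrivial Q).ne
  have hA : IsPGroup p (Abelianization Q) := hQ.to_quotient _
  have hexp : p ^ 1 ≤ Monoid.exponent (Abelianization Q) := by
    obtain ⟨x, hx⟩ := exists_ne (1 : Abelianization Q)
    obtain ⟨m, hm⟩ := IsPGroup.iff_orderOf.1 hA x
    have hm0 : m ≠ 0 := by
      rintro rfl
      exact hx (orderOf_eq_one_iff.1 (by simpa using hm))
    rw [pow_one]
    refine Nat.le_of_dvd (Monoid.exponent_pos.2 Monoid.ExponentExists.of_finite)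
      (((dvd_pow_self p hm0).trans hm.symm.dvd).trans (Monoid.order_dvd_exponent x))
  obtain ⟨f, x, hfx⟩ := exists_hom_mem_range hp hA
    (w := (⟨z, Subgroup.mem_zpowers z⟩ : Subgroup.zpowers z)) (a := 1)
    (Subtype.ext (by simpa using hzp)) hexp
  have hle : Subgroup.zpowers z ≤ Subgroup.center G := by rwa [Subgroup.zpowers_le]
  let F : G →* Subgroup.center G := (Subgroup.inclusion hle).comp
    ((f.comp Abelianization.of).comp (QuotientGroup.mk' _))
  have hF : ∀ y ∈ Subgroup.center G, y * F y = 1 → y = 1 := by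
    intro y _ h1
    have hy : y ∈ Subgroup.zpowers z := by
      rw [mul_eq_one_iff_eq_inv.1 h1]
      exact inv_mem (f (Abelianization.of (QuotientGroup.mk' _ y))).2
    have hFy : F y = 1 := by
      have : (QuotientGroup.mk' (Subgroup.zpowers z)) y = 1 := (QuotientGroup.eq_one_iff y).2 hy
      rw [MonoidHom.comp_apply, MonoidHom.comp_apply, this, map_one, map_one]
    simpa [hFy] using h1
  obtain ⟨q, rfl⟩ := QuotientGroup.mk_surjective x
  obtain ⟨g, rfl⟩ := QuotientGroup.mk_surjective q
  have hg : (F g : G) = z := congrArg Subtype.val hfx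
  rw [← hg]
  exact (coe_hom_mem_gammaTerm_of_autClass_eq hk h F hF).1 g

/-- If `z ≠ 1`, a power `y` of `z` has order `p`, so it lies in the commutator subgroup and `f y =
1`; but `y = f(y)⁻¹`, a contradiction. -/
theorem MonoidHom.eq_one_of_mul_eq_one_of_socle_le {p : ℕ} (hp : p.Prime) (hG : IsPGroup p G)
    (hsocle : ∀ z ∈ Subgroup.center G, z ^ p = 1 → z ∈ commutator G)
    (f : G →* Subgroup.center G) {z : G} (hz : z ∈ Subgroup.center G) (h : z * f z = 1) :
    z = 1 := by
  by_contra hne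
  have := Fact.mk hp
  obtain ⟨m, hm⟩ := IsPGroup.iff_orderOf.1 hG z
  have hm0 : m ≠ 0 := by
    rintro rfl
    exact hne (orderOf_eq_one_iff.1 (by simpa using hm))
  have hy : orderOf (z ^ p ^ (m - 1)) = p := by
    rw [orderOf_pow_of_dvd (pow_ne_zero _ hp.ne_zero) (hm ▸ pow_dvd_pow _ (Nat.sub_le _ _)), hm,
      Nat.pow_div (Nat.sub_le _ _) hp.pos, show m - (m - 1) = 1 by omega, pow_one]
  have hfy := f.eq_one_of_mem_commutator
    (hsocle (z ^ p ^ (m - 1)) (pow_mem hz _) (by rw [← orderOf_dvd_iff_pow_eq_one, hy]))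
  have hpow : z ^ p ^ (m - 1) = 1 := by
    rw [map_pow] at hfy
    have h1 := congrArg (fun y : Subgroup.center G => (y : G)) hfy
    simp only [Subgroup.coe_pow, Subgroup.coe_one] at h1
    rw [mul_eq_one_iff_eq_inv.1 h, inv_pow, h1, inv_one]
  rw [hpow, orderOf_one] at hy
  exact hp.one_lt.ne hy

theorem apply_mem_gammaTerm_of_autClass_eq [Finite G] {p : ℕ} (hp : p.Prime) (hG : IsPGroup p G)
    (hna : ¬ ∀ a b : G, a * b = b * a) (hk : 1 ≤ k) (h : AutClass G k = Autcent G)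
    (f : G →* Subgroup.center G) :
    (∀ g, (f g : G) ∈ gammaTerm G (k + 1)) ∧ ∀ z ∈ Subgroup.center G, f z = 1 :=
  coe_hom_mem_gammaTerm_of_autClass_eq hk h f fun _ hz =>
    f.eq_one_of_mul_eq_one_of_socle_le hp hG (fun _ hy hyp => gammaTerm_succ_le_commutator G hk
      (mem_gammaTerm_of_pow_eq_one hp hG hna hk h hy hyp)) hz

theorem exists_isCyclicDecomposition_of_autClass_eq [Finite G] {p : ℕ} (hp : p.Prime)
    (hG : IsPGroup p G) (hna : ¬ ∀ a b : G, a * b = b * a) (hk : 1 ≤ k)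
    (h : AutClass G k = Autcent G) :
    ∃ (s : ℕ) (e f : Fin s → ℕ), IsCyclicDecomposition p (gammaTerm G (k + 1)) e ∧
      IsCyclicDecomposition p (Subgroup.center G) f := by
  have hle := gammaTerm_le_center_of_autClass_eq hk h
  have hcomm : IsMulCommutative (gammaTerm G (k + 1)) :=
    ⟨⟨fun a b => Subtype.ext (Subgroup.mem_center_iff.1 (hle b.2) a)⟩⟩
  obtain ⟨s, e, he⟩ := exists_isCyclicDecomposition hp (hG.to_subgroup (gammaTerm G (k + 1)))
  obtain ⟨t, f, hf⟩ := exists_isCyclicDecomposition hp (hG.to_subgroup (Subgroup.center G))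
  obtain rfl := rank_eq_of_torsion_mem hp hle
    (fun z hz hzp => mem_gammaTerm_of_pow_eq_one hp hG hna hk h hz hzp) he hf
  exact ⟨s, e, f, he, hf⟩

theorem gammaTerm_eq_center_of_varPair_lt [Finite G] {p : ℕ} (hp : p.Prime) (hG : IsPGroup p G)
    (hna : ¬ ∀ a b : G, a * b = b * a) (hk : 1 ≤ k) (h : AutClass G k = Autcent G)
    (hv : varPair p (gammaTerm G (k + 1)) (Subgroup.center G) <
      Monoid.exponent (G ⧸ gammaTerm G 2)) :
    gammaTerm G (k + 1) = Subgroup.center G := by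
  have := Fact.mk hp
  obtain ⟨s, e, f, he, hf⟩ := exists_isCyclicDecomposition_of_autClass_eq hp hG hna hk h
  have hvar : IsVar p (gammaTerm G (k + 1)) (Subgroup.center G) (varPair p _ _) :=
    Nat.sInf_mem (exists_isVar hp (gammaTerm_le_center_of_autClass_eq hk h) he hf)
  have hA : IsPGroup p (Abelianization G) := hG.to_quotient _
  refine eq_of_isVar_lt hp hvar (isPGroup_iff_exponent_eq_pow.1 hA) hv fun a ha z hz hza => ?_
  obtain ⟨φ, x, hx⟩ := exists_hom_mem_range hp hA (w := (⟨z, hz⟩ : Subgroup.center G))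
    (Subtype.ext (by simpa using hza)) ha
  obtain ⟨g, rfl⟩ := QuotientGroup.mk_surjective x
  have := (apply_mem_gammaTerm_of_autClass_eq hp hG hna hk h (φ.comp Abelianization.of)).1 g
  rw [MonoidHom.comp_apply, show φ (Abelianization.of g) = _ from hx] at this
  exact this

theorem isoToHom_of_autClass_eq [Finite G] (h : AutClass G k = Autcent G) :
    IsoToHom (AutClass G k) (G ⧸ Subgroup.center G) (Subgroup.center G) := by
  refine isoToHom_of_mulEquiv (MulEquiv.ofBijective (centralHom (AutClass G k) h.le
    fun _ hα _ hz => apply_eq_of_mem_autClass_of_mem_center hα hz)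
    ⟨centralHom_injective _ _, fun φ => ?_⟩)
  -- The pullback of `φ` is trivial on the centre, so `z f(z) = z` there.
  obtain ⟨α, hα, hαf⟩ := exists_mem_autcent (φ.comp (QuotientGroup.mk' _)) fun z hz hz1 => by
    have : QuotientGroup.mk' (Subgroup.center G) z = 1 := (QuotientGroup.eq_one_iff z).2 hz
    rwa [MonoidHom.comp_apply, this, map_one, Subgroup.coe_one, mul_one] at hz1
  refine ⟨⟨α, h ▸ hα⟩, ?_⟩
  ext g
  change g⁻¹ * α g = _
  rw [hαf, inv_mul_cancel_left]

/-- For central `α`, the map `g ↦ g⁻¹ α(g)` kills commutators, hence the centre, so it factors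
through `G/Z(G)`. Equal orders make `centralHom` surjective, so a class preserving automorphism
induces the same map and equals `α`. -/
theorem autClass_eq_autcent_of_card [Finite G] (hk : 1 ≤ k)
    (hZ : gammaTerm G (k + 1) = Subgroup.center G)
    (hcard : Nat.card (AutClass G k) =
      Nat.card (G ⧸ Subgroup.center G →* Subgroup.center G)) : AutClass G k = Autcent G := by
  have hle : AutClass G k ≤ Autcent G := fun β hβ g =>
    hZ ▸ inv_mul_apply_mem_of_mem_autClass hk hβ g
  refine le_antisymm hle fun α hα => ?_
  have hfin : Finite (G ⧸ Subgroup.center G →* Subgroup.center G) :=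
    Finite.of_injective _ DFunLike.coe_injective
  have hbij := (centralHom_injective hle
    fun _ hα _ hz => apply_eq_of_mem_autClass_of_mem_center hα hz).bijective_of_nat_card_le
      hcard.ge
  obtain ⟨β, hβ⟩ := hbij.2 (QuotientGroup.lift _ (Autcent.hom α hα) fun z hz =>
    (Autcent.hom α hα).eq_one_of_mem_commutator
      (gammaTerm_succ_le_commutator G hk (hZ ▸ hz)))
  have hαβ : α = β.1 := by
    ext g
    have h' := congrArg Subtype.val (DFunLike.congr_fun hβ (g : G ⧸ Subgroup.center G))
    exact (mul_left_cancel (h' : g⁻¹ * β.1 g = g⁻¹ * α g)).symm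
  exact hαβ ▸ β.2

theorem varPair_self_lt_exponent [Finite G] {p : ℕ} (hp : p.Prime) (hG : IsPGroup p G)
    (hna : ¬ ∀ a b : G, a * b = b * a) (H : Subgroup G) :
    varPair p H H < Monoid.exponent (G ⧸ gammaTerm G 2) := by
  have := Fact.mk hp
  -- The value `1` belongs to the set, so its infimum is at most `1`.
  have hv : varPair p H H ≤ 1 := Nat.sInf_le (Or.inl ⟨rfl, rfl⟩)
  refine hv.trans_lt ?_
  have : Nontrivial G := by
    by_contra h
    rw [not_nontrivial_iff_subsingleton] at h
    exact hna fun a b => Subsingleton.elim _ _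
  have : Group.IsNilpotent G := hG.isNilpotent
  have hQ : Nontrivial (G ⧸ gammaTerm G 2) :=
    QuotientGroup.nontrivial_iff.2 (Group.IsSolvable.commutator_lt_top_of_nontrivial G).ne
  have h0 : 0 < Monoid.exponent (G ⧸ gammaTerm G 2) :=
    Monoid.exponent_pos.2 Monoid.ExponentExists.of_finite
  have h1 : Monoid.exponent (G ⧸ gammaTerm G 2) ≠ 1 := fun h =>
    not_subsingleton _ (Monoid.exp_eq_one_iff.1 h)
  omega

end AutClassEqAutcent

end

theorem theoremt4 (p : ℕ) (hp : p.Prime) (G : Type*) [Group G] [Finite G] (hG : IsPGroup p G)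
    (hna : ¬ ∀ a b : G, a * b = b * a) (n : ℕ) (hn : 2 ≤ n) :
    (AutClass G (n - 1) = Autcent G →
      (gammaTerm G n ≤ Subgroup.center G ∧
        Group.rank (gammaTerm G n) = Group.rank (Subgroup.center G)) ∧
      (varPair p (gammaTerm G n) (Subgroup.center G) < Monoid.exponent (G ⧸ gammaTerm G 2) →
        gammaTerm G n = Subgroup.center G ∧
        IsoToHom (AutClass G (n - 1)) (G ⧸ Subgroup.center G) (gammaTerm G n))) ∧
    (gammaTerm G n = Subgroup.center G →
      IsoToHom (AutClass G (n - 1)) (G ⧸ Subgroup.center G) (gammaTerm G n) →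
      AutClass G (n - 1) = Autcent G ∧
      varPair p (gammaTerm G n) (Subgroup.center G) < Monoid.exponent (G ⧸ gammaTerm G 2)) := by
  obtain ⟨k, rfl⟩ := Nat.exists_eq_add_of_le' (one_le_two.trans hn)
  have hk : 1 ≤ k := by omega
  rw [Nat.add_sub_cancel]
  refine ⟨fun h => ⟨⟨gammaTerm_le_center_of_autClass_eq hk h, ?_⟩, fun hv => ?_⟩, fun hZ hiso => ?_⟩
  · obtain ⟨s, e, f, he, hf⟩ := exists_isCyclicDecomposition_of_autClass_eq hp hG hna hk h
    rw [rank_eq_of_isCyclicDecomposition hp he, rank_eq_of_isCyclicDecomposition hp hf]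
  · have hZ := gammaTerm_eq_center_of_varPair_lt hp hG hna hk h hv
    refine ⟨hZ, ?_⟩
    rw [hZ]
    exact isoToHom_of_autClass_eq h
  · rw [hZ] at hiso ⊢
    exact ⟨autClass_eq_autcent_of_card hk hZ hiso.card_eq, varPair_self_lt_exponent hp hG hna _⟩
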